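/- Identify operators on $\mathbb{C}^2\otimes\mathbb{C}^2$ with $4\times4$ complex matrices. Let $\mathrm{SEP}$ be the cone of all finite sums $\sum_i X_i\otimes Y_i$ with $X_i,Y_i$ positive semi-definite $2\times 2$ complex matrices, and let $\mathrm{SEP}^*$ be the set of all Hermitian $4\times 4$ matrices $Y$ such that $\operatorname{Tr}XY\ge 0$ for every $X\in\mathrm{SEP}$. Two states (trace-one elements of $\mathrm{SEP}$) $\rho_1,\rho_2$ are called perfectly distinguishable in $\mathrm{SEP}$ if there are $M_1,M_2\in\mathrm{SEP}^*$ with $M_1+M_2=I$ and $\operatorname{Tr}M_j\rho_i=\delta_{ij}$ for all $i,j\in\{1,2\}$. Let $$ \rho_1=\begin{bmatrix}1-p_1&0\\0&p_1\end{bmatrix}\otimes\begin{bmatrix}1-p_2&0\\0&p_2\end{bmatrix},\qquad \rho_2=\begin{bmatrix}1-\alpha_1&\beta_1\\\beta_1&\alpha_1\end{bmatrix}\otimes\begin{bmatrix}1-\alpha_2&\beta_2\\\beta_2&\alpha_2\end{bmatrix}, $$ where $\alpha_i,p_i\in[0,1]$, $\beta_i\ge 0$ and $\beta_i^2\le\alpha_i(1-\alpha_i)$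 for $i=1,2$. If $\rho_1$ and $\rho_2$ are perfectly distinguishable in $\mathrm{SEP}$, then $$ \operatorname{Tr}\rho_1\rho_2\le\beta_1\beta_2\,\bigl|(2p_1-1)(2p_2-1)\bigr|\le\beta_1\beta_2\le\tfrac14 . $$ If in addition $p_1=p_2=0$, then $\alpha_1+\alpha_2\ge 1$. -/

import Mathlib

open scoped Kronecker ComplexOrder

namespace SepGPT

/-- The cone of separable matrices on `ℂ^m ⊗ ℂ^n`: finite sums of tensor products of
positive semi-definite matrices. -/
def sepCone (m n : Type*) [Fintype m] [Fintype n] : Set (Matrix (m × n) (m × n) ℂ) :=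
  {X | ∃ (k : ℕ) (A : Fin k → Matrix m m ℂ) (B : Fin k → Matrix n n ℂ),
    (∀ i, (A i).PosSemidef) ∧ (∀ i, (B i).PosSemidef) ∧ X = ∑ i, A i ⊗ₖ B i}

/-- The dual cone of the separable cone, inside the Hermitian matrices. The trace of a product of
two Hermitian matrices is real, so its real part is the trace itself. -/
def sepDual (m n : Type*) [Fintype m] [Fintype n] : Set (Matrix (m × n) (m × n) ℂ) :=
  {Y | Y.IsHermitian ∧ ∀ X ∈ sepCone m n, 0 ≤ (X * Y).trace.re}

/-- Measurements of SEP: families in the dual cone that sum to the identity. -/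
def IsMeasurement {m n ι : Type*} [Fintype m] [Fintype n] [DecidableEq m] [DecidableEq n]
    [Fintype ι] (M : ι → Matrix (m × n) (m × n) ℂ) : Prop :=
  (∀ i, M i ∈ sepDual m n) ∧ ∑ i, M i = 1

/-- A family of states is perfectly distinguishable in SEP if some measurement of SEP,
indexed by the same set, satisfies `Tr (M j) (ρ i) = δ i j`. -/
def PerfectlyDistinguishable {m n ι : Type*} [Fintype m] [Fintype n] [DecidableEq m]
    [DecidableEq n] [Fintype ι] [DecidableEq ι] (ρ : ι → Matrix (m × n) (m × n) ℂ) : Prop :=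
  ∃ M : ι → Matrix (m × n) (m × n) ℂ, IsMeasurement M ∧
    ∀ i j, (M j * ρ i).trace = if i = j then 1 else 0

end SepGPT

namespace SepGPT

/-! ### From measurements to bilinear forms on real symmetric matrices. -/

open Matrix

/-! All four marginals are real symmetric, so the effect accepting `ρ₂` matters only through a
bilinear form `q` on pairs of such matrices. On positive pairs `q` lies between 0 and the product of
the traces; it is 0 at the first product state and 1 at the second.

If a marginal is positive definite, fixing its partner leaves a positive functional vanishing at an
interior point, hence everywhere. One factor alone then separates the states, and the overlap is 0
(`IsEffect.symTrace_mul_eq_zero`).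

Otherwise all marginals are pure, and exchanging diagonal entries reduces to `p₁ = p₂ = 0`. Let the
Bloch angles of the second state be `2a` and `2b`. Reflect each Bloch circle in the direction
halfway between its two states: this exchanges the two product states, so the part of `q` odd under
the joint reflection changes by 1 between them. Bounding that part on pairs of complementary angles
caps the change by `sin (a + b)` when `a + b < π / 2`, a contradiction (`combination_le_of_circle`,
`IsEffect.mul_le_mul_of_pure`). Thus `cos a * cos b ≤ sin a * sin b`; multiplying by `cos a * cos b`
gives the trace bound. -/

/-- The real symmetric `2 × 2` matrix with diagonal `(a 0, a 1)` and off-diagonal entry `a 2`,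
as a complex matrix. -/
noncomputable def symMat (a : Fin 3 → ℝ) : Matrix (Fin 2) (Fin 2) ℂ :=
  !![(a 0 : ℂ), (a 2 : ℂ); (a 2 : ℂ), (a 1 : ℂ)]

/-- Coordinates of positive semi-definite real symmetric `2 × 2` matrices. -/
def IsPos (a : Fin 3 → ℝ) : Prop := 0 ≤ a 0 ∧ 0 ≤ a 1 ∧ a 2 ^ 2 ≤ a 0 * a 1

/-- Bilinear forms on real symmetric matrices that come from an effect on product states. -/
def IsEffect (q : (Fin 3 → ℝ) →ₗ[ℝ] (Fin 3 → ℝ) →ₗ[ℝ] ℝ) : Prop :=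
  ∀ a b, IsPos a → IsPos b → 0 ≤ q a b ∧ q a b ≤ (a 0 + a 1) * (b 0 + b 1)

theorem symMat_add (a b : Fin 3 → ℝ) : symMat (a + b) = symMat a + symMat b := by
  ext i j; fin_cases i <;> fin_cases j <;> simp [symMat]

theorem symMat_smul (r : ℝ) (a : Fin 3 → ℝ) : symMat (r • a) = (r : ℂ) • symMat a := by
  ext i j; fin_cases i <;> fin_cases j <;> simp [symMat]

theorem trace_symMat (a : Fin 3 → ℝ) : (symMat a).trace = ((a 0 + a 1 : ℝ) : ℂ) := by
  simp [symMat, Matrix.trace_fin_two]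

theorem IsPos.posSemidef_symMat {a : Fin 3 → ℝ} (ha : IsPos a) : (symMat a).PosSemidef := by
  obtain ⟨h0, h1, h2⟩ := ha
  rw [posSemidef_iff_dotProduct_mulVec]
  refine ⟨?_, fun x => ?_⟩
  · ext i j; fin_cases i <;> fin_cases j <;> simp [symMat]
  · rw [Complex.le_def]
    simp only [symMat, dotProduct, mulVec, Fin.sum_univ_two]
    simp
    constructor
    · set u := (x 0).re
      set v := (x 1).re
      set s := (x 0).im
      set t := (x 1).im
      have quad : ∀ u v : ℝ, 0 ≤ a 0 * u ^ 2 + a 1 * v ^ 2 + 2 * a 2 * u * v := by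
        intro u v
        rcases h0.eq_or_lt with h | h
        · have : a 2 = 0 := by
            rw [← h] at h2
            exact pow_eq_zero_iff two_ne_zero |>.1 (le_antisymm (by linarith) (sq_nonneg _))
          rw [← h, this]
          nlinarith [mul_nonneg h1 (sq_nonneg v)]
        · refine nonneg_of_mul_nonneg_right ?_ h
          nlinarith [sq_nonneg (a 0 * u + a 2 * v), mul_nonneg (sub_nonneg.2 h2) (sq_nonneg v)]
      -- The off-diagonal entry is real, so the Hermitian form splits into the real form at the real
      -- parts plus the same form at the imaginary parts.
      have := quad u v
      have := quad s t
      nlinarith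
    · ring

/-- The bilinear form induced by a matrix on pairs of real symmetric matrices. -/
noncomputable def symForm (M : Matrix (Fin 2 × Fin 2) (Fin 2 × Fin 2) ℂ) :
    (Fin 3 → ℝ) →ₗ[ℝ] (Fin 3 → ℝ) →ₗ[ℝ] ℝ :=
  LinearMap.mk₂ ℝ (fun a b => ((symMat a ⊗ₖ symMat b) * M).trace.re)
    (fun a a' b => by simp [symMat_add, add_kronecker, Matrix.add_mul])
    (fun r a b => by simp [symMat_smul, smul_kronecker])
    (fun a b b' => by simp [symMat_add, kronecker_add, Matrix.add_mul])
    (fun r a b => by simp [symMat_smul, kronecker_smul])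

theorem symForm_apply (M : Matrix (Fin 2 × Fin 2) (Fin 2 × Fin 2) ℂ) (a b : Fin 3 → ℝ) :
    symForm M a b = ((symMat a ⊗ₖ symMat b) * M).trace.re := rfl

theorem kronecker_mem_sepCone {m n : Type*} [Fintype m] [Fintype n] {A : Matrix m m ℂ}
    {B : Matrix n n ℂ} (hA : A.PosSemidef) (hB : B.PosSemidef) : A ⊗ₖ B ∈ sepCone m n :=
  ⟨1, fun _ => A, fun _ => B, fun _ => hA, fun _ => hB, by simp⟩

/-- The upper bound is positivity of the complementary effect `N = 1 - M` on product states. -/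
theorem isEffect_symForm {M N : Matrix (Fin 2 × Fin 2) (Fin 2 × Fin 2) ℂ}
    (hM : M ∈ sepDual (Fin 2) (Fin 2)) (hN : N ∈ sepDual (Fin 2) (Fin 2)) (hMN : N + M = 1) :
    IsEffect (symForm M) := by
  intro a b ha hb
  have hmem := kronecker_mem_sepCone ha.posSemidef_symMat hb.posSemidef_symMat
  have h1 := hM.2 _ hmem
  have h2 := hN.2 _ hmem
  refine ⟨h1, ?_⟩
  have h3 : ((symMat a ⊗ₖ symMat b) * (N + M)).trace.re = (a 0 + a 1) * (b 0 + b 1) := by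
    rw [hMN, Matrix.mul_one, trace_kronecker, trace_symMat, trace_symMat, ← Complex.ofReal_mul,
      Complex.ofReal_re]
  rw [Matrix.mul_add, trace_add, Complex.add_re] at h3
  rw [symForm_apply]
  linarith

/-! ### Positive functionals on real symmetric `2 × 2` matrices. -/

theorem linearMap_apply_eq (f : (Fin 3 → ℝ) →ₗ[ℝ] ℝ) (a : Fin 3 → ℝ) :
    f a = a 0 * f ![1, 0, 0] + a 1 * f ![0, 1, 0] + a 2 * f ![0, 0, 1] := by
  have : a = a 0 • ![1, 0, 0] + a 1 • ![0, 1, 0] + a 2 • ![0, 0, 1] := by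
    ext i; fin_cases i <;> simp
  conv_lhs => rw [this]
  simp only [map_add, map_smul, smul_eq_mul]

/-- The trace of the product of two real symmetric matrices. -/
def symTrace (a b : Fin 3 → ℝ) : ℝ := a 0 * b 0 + a 1 * b 1 + 2 * (a 2 * b 2)

/-- A functional that is nonnegative on positive semi-definite matrices is represented by a
positive semi-definite matrix. -/
theorem isPos_coeff {f : (Fin 3 → ℝ) →ₗ[ℝ] ℝ} (hf : ∀ a, IsPos a → 0 ≤ f a) :
    IsPos ![f ![1, 0, 0], f ![0, 1, 0], f ![0, 0, 1] / 2] := by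
  have h0 := hf ![1, 0, 0] (by simp [IsPos])
  have h1 := hf ![0, 1, 0] (by simp [IsPos])
  refine ⟨h0, h1, show (f ![0, 0, 1] / 2) ^ 2 ≤ f ![1, 0, 0] * f ![0, 1, 0] from ?_⟩
  have key : ∀ t : ℝ, 0 ≤ f ![1, 0, 0] * (t * t) + f ![0, 0, 1] * t + f ![0, 1, 0] := by
    intro t
    -- Rank-one matrices turn positivity of `f` into a nonnegative quadratic in `t`, whose
    -- discriminant gives the determinant condition.
    have := hf ![t ^ 2, 1, t] ⟨by simp; positivity, by simp, by simp⟩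
    rw [linearMap_apply_eq] at this
    simp at this
    linarith
  have := discrim_le_zero key
  unfold discrim at this
  linarith

/-- If the product of two positive semi-definite real symmetric matrices has trace zero, then the
product vanishes. -/
theorem mul_eq_zero_of_symTrace {f p : Fin 3 → ℝ} (hf : IsPos f) (hp : IsPos p)
    (h : symTrace f p = 0) :
    f 0 * p 0 + f 2 * p 2 = 0 ∧ f 0 * p 2 + f 2 * p 1 = 0 ∧
      f 2 * p 0 + f 1 * p 2 = 0 ∧ f 2 * p 2 + f 1 * p 1 = 0 := by
  obtain ⟨f0, f1, f2⟩ := hf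
  obtain ⟨p0, p1, p2⟩ := hp
  unfold symTrace at h
  have hprod : f 2 ^ 2 * p 2 ^ 2 ≤ (f 0 * f 1) * (p 0 * p 1) :=
    mul_le_mul f2 p2 (sq_nonneg _) (mul_nonneg f0 f1)
  -- Equality case of AM-GM: the squared sum of the two diagonal products is at most four times
  -- their product, so they coincide.
  have hd : f 0 * p 0 - f 1 * p 1 = 0 := by
    have hs : f 0 * p 0 + f 1 * p 1 = - (2 * (f 2 * p 2)) := by linarith
    have hs2 : (f 0 * p 0 + f 1 * p 1) ^ 2 = 4 * (f 2 ^ 2 * p 2 ^ 2) := by rw [hs]; ring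
    refine pow_eq_zero_iff two_ne_zero |>.1 (le_antisymm ?_ (sq_nonneg _))
    nlinarith
  -- The determinant bounds dominate the expanded square by `f 0 * p 1` times the vanishing trace.
  have e1 : (f 0 * p 2 + f 2 * p 1) ^ 2 ≤ 0 := by
    have i1 := mul_le_mul_of_nonneg_left p2 (sq_nonneg (f 0))
    have i2 := mul_le_mul_of_nonneg_right f2 (sq_nonneg (p 1))
    have i3 : f 0 * p 1 * (f 0 * p 0 + f 1 * p 1 + 2 * (f 2 * p 2)) = 0 := by rw [h, mul_zero]
    nlinarith
  have e2 : (f 2 * p 0 + f 1 * p 2) ^ 2 ≤ 0 := by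
    have i1 := mul_le_mul_of_nonneg_left p2 (sq_nonneg (f 1))
    have i2 := mul_le_mul_of_nonneg_right f2 (sq_nonneg (p 0))
    have i3 : f 1 * p 0 * (f 0 * p 0 + f 1 * p 1 + 2 * (f 2 * p 2)) = 0 := by rw [h, mul_zero]
    nlinarith
  exact ⟨by linarith, pow_eq_zero_iff two_ne_zero |>.1 (le_antisymm e1 (sq_nonneg _)),
    pow_eq_zero_iff two_ne_zero |>.1 (le_antisymm e2 (sq_nonneg _)), by linarith⟩

theorem eq_symTrace (f : (Fin 3 → ℝ) →ₗ[ℝ] ℝ) (p : Fin 3 → ℝ) :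
    f p = symTrace ![f ![1, 0, 0], f ![0, 1, 0], f ![0, 0, 1] / 2] p := by
  rw [linearMap_apply_eq]
  simp [symTrace]
  ring

/-- A positive functional that vanishes at a positive definite matrix is zero. -/
theorem eq_zero_of_posDef {f : (Fin 3 → ℝ) →ₗ[ℝ] ℝ} (hf : ∀ a, IsPos a → 0 ≤ f a)
    {p : Fin 3 → ℝ} (hp : IsPos p) (hdet : p 2 ^ 2 < p 0 * p 1) (hfp : f p = 0)
    (a : Fin 3 → ℝ) : f a = 0 := by
  rw [eq_symTrace] at hfp
  obtain ⟨h1, h2, h3, h4⟩ := mul_eq_zero_of_symTrace (isPos_coeff hf) hp hfp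
  simp at h1 h2 h3 h4
  -- The four equations say that the matrix product is 0; multiplying by the adjugate of `p` leaves
  -- `det p` times each coefficient of `f`.
  have hD : p 0 * p 1 - p 2 ^ 2 ≠ 0 := (sub_pos.2 hdet).ne'
  have c0 : f ![1, 0, 0] = 0 := (mul_eq_zero.1 (show f ![1, 0, 0] * (p 0 * p 1 - p 2 ^ 2) = 0 by
    linear_combination p 1 * h1 - p 2 * h2)).resolve_right hD
  have c1 : f ![0, 1, 0] = 0 := (mul_eq_zero.1 (show f ![0, 1, 0] * (p 0 * p 1 - p 2 ^ 2) = 0 by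
    linear_combination p 0 * h4 - p 2 * h3)).resolve_right hD
  have c2 : f ![0, 0, 1] = 0 := (mul_eq_zero.1 (show f ![0, 0, 1] * (p 0 * p 1 - p 2 ^ 2) = 0 by
    linear_combination 2 * p 0 * h2 - 2 * p 2 * h1)).resolve_right hD
  rw [linearMap_apply_eq, c0, c1, c2]
  ring

/-- The trace as a functional on real symmetric matrices. -/
noncomputable def traceForm : (Fin 3 → ℝ) →ₗ[ℝ] ℝ :=
  (LinearMap.proj 0 : (Fin 3 → ℝ) →ₗ[ℝ] ℝ) + LinearMap.proj 1

theorem traceForm_apply (a : Fin 3 → ℝ) : traceForm a = a 0 + a 1 := rfl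

/-- States that are perfectly distinguished by a single real effect are orthogonal. -/
theorem symTrace_eq_zero_of_effect {f : (Fin 3 → ℝ) →ₗ[ℝ] ℝ}
    (hf : ∀ a, IsPos a → 0 ≤ f a ∧ f a ≤ a 0 + a 1) {p s : Fin 3 → ℝ} (hp : IsPos p)
    (hs : IsPos s) (hs1 : s 0 + s 1 = 1) (hfp : f p = 0) (hfs : f s = 1) : symTrace p s = 0 := by
  have hg : ∀ a, IsPos a → 0 ≤ (traceForm - f) a := fun a ha => by
    rw [LinearMap.sub_apply, traceForm_apply]; linarith [(hf a ha).2]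
  have hgs : (traceForm - f) s = 0 := by rw [LinearMap.sub_apply, traceForm_apply]; linarith
  rw [eq_symTrace] at hfp hgs
  obtain ⟨h1, h2, h3, h4⟩ := mul_eq_zero_of_symTrace (isPos_coeff fun a ha => (hf a ha).1) hp hfp
  obtain ⟨k1, k2, k3, k4⟩ := mul_eq_zero_of_symTrace (isPos_coeff hg) hs hgs
  simp [traceForm_apply] at h1 h2 h3 h4 k1 k2 k3 k4
  unfold symTrace
  -- With `F` representing `f`, this is `tr PS = tr P(1 - F)S + tr PFS`, where `(1 - F)S = 0` and
  -- `PF = (FP)ᵀ = 0`.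
  linear_combination p 0 * k1 + p 2 * k2 + p 2 * k3 + p 1 * k4 + s 0 * h1 + s 2 * h2 + s 2 * h3
    + s 1 * h4

/-! ### States with a positive definite marginal. -/

theorem IsEffect.flip {q : (Fin 3 → ℝ) →ₗ[ℝ] (Fin 3 → ℝ) →ₗ[ℝ] ℝ} (hq : IsEffect q) :
    IsEffect q.flip := fun a b ha hb => by
  rw [LinearMap.flip_apply, mul_comm]
  exact hq b a hb ha

/-- The effect complementary to `q`. -/
noncomputable def complForm (q : (Fin 3 → ℝ) →ₗ[ℝ] (Fin 3 → ℝ) →ₗ[ℝ] ℝ) :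
    (Fin 3 → ℝ) →ₗ[ℝ] (Fin 3 → ℝ) →ₗ[ℝ] ℝ :=
  (LinearMap.mul ℝ ℝ).compl₁₂ traceForm traceForm - q

theorem complForm_apply (q : (Fin 3 → ℝ) →ₗ[ℝ] (Fin 3 → ℝ) →ₗ[ℝ] ℝ) (a b : Fin 3 → ℝ) :
    complForm q a b = (a 0 + a 1) * (b 0 + b 1) - q a b := rfl

theorem IsEffect.compl {q : (Fin 3 → ℝ) →ₗ[ℝ] (Fin 3 → ℝ) →ₗ[ℝ] ℝ} (hq : IsEffect q) :
    IsEffect (complForm q) := fun a b ha hb => by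
  rw [complForm_apply]
  have := hq a b ha hb
  constructor <;> linarith

/-- The functional `q · p₂` vanishes at the interior point `p₁`, hence also at `s₁`. So `q s₁` is an
effect on the second factor alone that separates `p₂` from `s₂`. -/
theorem IsEffect.symTrace_eq_zero_of_posDef {q : (Fin 3 → ℝ) →ₗ[ℝ] (Fin 3 → ℝ) →ₗ[ℝ] ℝ}
    (hq : IsEffect q) {p₁ p₂ s₁ s₂ : Fin 3 → ℝ} (hp₁ : IsPos p₁) (hp₂ : IsPos p₂)
    (hs₁ : IsPos s₁) (hs₂ : IsPos s₂) (hs₁' : s₁ 0 + s₁ 1 = 1) (hs₂' : s₂ 0 + s₂ 1 = 1)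
    (hqp : q p₁ p₂ = 0) (hqs : q s₁ s₂ = 1) (hdet : p₁ 2 ^ 2 < p₁ 0 * p₁ 1) :
    symTrace p₂ s₂ = 0 := by
  have h0 : q s₁ p₂ = 0 := by
    have := eq_zero_of_posDef (f := q.flip p₂) (fun a ha => (hq a p₂ ha hp₂).1) hp₁ hdet hqp s₁
    exact this
  refine symTrace_eq_zero_of_effect (f := q s₁) (fun a ha => ?_) hp₂ hs₂ hs₂' h0 hqs
  have := hq s₁ a hs₁ ha
  rwa [hs₁', one_mul] at this

theorem symTrace_comm (a b : Fin 3 → ℝ) : symTrace a b = symTrace b a := by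
  unfold symTrace; ring

/-- If one of the four marginals of a perfectly distinguished pair of product states is positive
definite, then the pair is orthogonal. -/
theorem IsEffect.symTrace_mul_eq_zero {q : (Fin 3 → ℝ) →ₗ[ℝ] (Fin 3 → ℝ) →ₗ[ℝ] ℝ}
    (hq : IsEffect q) {p₁ p₂ s₁ s₂ : Fin 3 → ℝ} (hp₁ : IsPos p₁) (hp₂ : IsPos p₂)
    (hs₁ : IsPos s₁) (hs₂ : IsPos s₂) (hp₁' : p₁ 0 + p₁ 1 = 1) (hp₂' : p₂ 0 + p₂ 1 = 1)
    (hs₁' : s₁ 0 + s₁ 1 = 1) (hs₂' : s₂ 0 + s₂ 1 = 1) (hqp : q p₁ p₂ = 0) (hqs : q s₁ s₂ = 1)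
    (hdet : p₁ 2 ^ 2 < p₁ 0 * p₁ 1 ∨ p₂ 2 ^ 2 < p₂ 0 * p₂ 1 ∨
      s₁ 2 ^ 2 < s₁ 0 * s₁ 1 ∨ s₂ 2 ^ 2 < s₂ 0 * s₂ 1) :
    symTrace p₁ s₁ * symTrace p₂ s₂ = 0 := by
  -- Complementing the effect exchanges the two states and flipping exchanges the factors, so one
  -- case yields all four.
  have c1 : complForm q p₁ p₂ = 1 := by rw [complForm_apply, hp₁', hp₂', hqp]; norm_num
  have c2 : complForm q s₁ s₂ = 0 := by rw [complForm_apply, hs₁', hs₂', hqs]; norm_num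
  rcases hdet with h | h | h | h
  · rw [hq.symTrace_eq_zero_of_posDef hp₁ hp₂ hs₁ hs₂ hs₁' hs₂' hqp hqs h, mul_zero]
  · rw [hq.flip.symTrace_eq_zero_of_posDef hp₂ hp₁ hs₂ hs₁ hs₂' hs₁' hqp hqs h, zero_mul]
  · rw [symTrace_comm p₂, hq.compl.symTrace_eq_zero_of_posDef hs₁ hs₂ hp₁ hp₂ hp₁' hp₂' c2 c1 h,
      mul_zero]
  · rw [symTrace_comm p₁, hq.compl.flip.symTrace_eq_zero_of_posDef hs₂ hs₁ hp₂ hp₁ hp₂' hp₁'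
      c2 c1 h, zero_mul]

/-! ### Pure product states on two Bloch circles. -/

/-- A quadratic polynomial without mixed term that is at most `1` on the unit circle is at most
`sin (a + b)` at `(sin a, sin b, sin a * cos b, cos a * sin b)` when `a + b` is acute. -/
theorem combination_le_of_circle {l m n k : ℝ}
    (h : ∀ u v : ℝ, u ^ 2 + v ^ 2 = 1 → l * u + m * v + n * u ^ 2 + k * v ^ 2 ≤ 1)
    {x₀ x₁ y₀ y₁ : ℝ} (hx₀ : 0 ≤ x₀) (hx₁ : 0 ≤ x₁) (hy₀ : 0 ≤ y₀) (hy₁ : 0 ≤ y₁)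
    (hx : x₀ ^ 2 + x₁ ^ 2 = 1) (hy : y₀ ^ 2 + y₁ ^ 2 = 1) (hxy : x₁ * y₁ ≤ x₀ * y₀)
    (hS : 0 < x₁ * y₀ + x₀ * y₁) :
    l * x₁ + m * y₁ + n * (x₁ * y₀) + k * (x₀ * y₁) ≤ x₁ * y₀ + x₀ * y₁ := by
  set S := x₁ * y₀ + x₀ * y₁ with hSdef
  have hz0 : 0 ≤ x₁ * y₀ / S := by positivity
  have hw0 : 0 ≤ x₀ * y₁ / S := by positivity
  -- The point `(r, w)` of the circle is chosen so that `S * r ^ 2` and `S * w ^ 2` are exactly the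
  -- arguments of `n` and `k`; the linear arguments are then at most `S * r` and `S * w`.
  set r := √(x₁ * y₀ / S)
  set w := √(x₀ * y₁ / S)
  have hr2 : r ^ 2 = x₁ * y₀ / S := Real.sq_sqrt hz0
  have hw2 : w ^ 2 = x₀ * y₁ / S := Real.sq_sqrt hw0
  have hrw : r ^ 2 + w ^ 2 = 1 := by rw [hr2, hw2, ← add_div, ← hSdef, div_self hS.ne']
  have hU : x₁ ≤ S * r := by
    refine abs_le_of_sq_le_sq' ?_ (by positivity) |>.2
    rw [mul_pow, hr2, show S ^ 2 * (x₁ * y₀ / S) = S * (x₁ * y₀) by field_simp]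
    have : S * (x₁ * y₀) - x₁ ^ 2 = x₁ * y₁ * (x₀ * y₀ - x₁ * y₁) := by
      rw [hSdef]; linear_combination x₁ ^ 2 * hy
    nlinarith [mul_nonneg (mul_nonneg hx₁ hy₁) (sub_nonneg.2 hxy)]
  have hV : y₁ ≤ S * w := by
    refine abs_le_of_sq_le_sq' ?_ (by positivity) |>.2
    rw [mul_pow, hw2, show S ^ 2 * (x₀ * y₁ / S) = S * (x₀ * y₁) by field_simp]
    have : S * (x₀ * y₁) - y₁ ^ 2 = x₁ * y₁ * (x₀ * y₀ - x₁ * y₁) := by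
      rw [hSdef]; linear_combination y₁ ^ 2 * hx
    nlinarith [mul_nonneg (mul_nonneg hx₁ hy₁) (sub_nonneg.2 hxy)]
  -- The quadratic terms ignore the signs of `u` and `v`, so these can be matched to the signs of
  -- `l` and `m`.
  have habs : |l| * r + |m| * w + n * r ^ 2 + k * w ^ 2 ≤ 1 := by
    have h1 := h r w hrw
    have h2 := h (-r) w (by rw [neg_sq]; exact hrw)
    have h3 := h r (-w) (by rw [neg_sq]; exact hrw)
    have h4 := h (-r) (-w) (by rw [neg_sq, neg_sq]; exact hrw)
    rcases abs_cases l with ⟨e, -⟩ | ⟨e, -⟩ <;> rcases abs_cases m with ⟨e', -⟩ | ⟨e', -⟩ <;>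
      rw [e, e'] <;> linarith
  have hl : l * x₁ ≤ |l| * (S * r) :=
    (mul_le_mul_of_nonneg_right (le_abs_self l) hx₁).trans
      (mul_le_mul_of_nonneg_left hU (abs_nonneg l))
  have hm : m * y₁ ≤ |m| * (S * w) :=
    (mul_le_mul_of_nonneg_right (le_abs_self m) hy₁).trans
      (mul_le_mul_of_nonneg_left hV (abs_nonneg m))
  have hn : n * (x₁ * y₀) = n * (S * r ^ 2) := by rw [hr2]; field_simp
  have hk : k * (x₀ * y₁) = k * (S * w ^ 2) := by rw [hw2]; field_simp
  have := mul_le_mul_of_nonneg_left habs hS.le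
  rw [hn, hk]
  linarith

/-- The projection with Bloch vector `c • (x₀, x₁) + s • (-x₁, x₀)`. -/
theorem isPos_rotation {x₀ x₁ c s : ℝ} (hx : x₀ ^ 2 + x₁ ^ 2 = 1) (hcs : c ^ 2 + s ^ 2 = 1) :
    IsPos (![1 / 2, 1 / 2, 0] + c • ![x₀ / 2, -x₀ / 2, x₁ / 2] +
      s • ![-x₁ / 2, x₁ / 2, x₀ / 2]) := by
  have h : (c * x₀ - s * x₁) ^ 2 + (c * x₁ + s * x₀) ^ 2 = 1 := by
    linear_combination (c ^ 2 + s ^ 2) * hx + hcs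
  have hb := abs_le.1 ((sq_le_one_iff_abs_le_one (c * x₀ - s * x₁)).1
    (by linarith [sq_nonneg (c * x₁ + s * x₀)]))
  refine ⟨?_, ?_, ?_⟩
  · simp; linarith
  · simp; linarith
  · simp
    nlinarith

/-- Pure product states with Bloch angles `(0, 0)` and `(2 a, 2 b)` can be distinguished only if
`a + b ≥ π / 2`. -/
theorem IsEffect.mul_le_mul_of_pure {q : (Fin 3 → ℝ) →ₗ[ℝ] (Fin 3 → ℝ) →ₗ[ℝ] ℝ}
    (hq : IsEffect q) {x₀ x₁ y₀ y₁ : ℝ} (hx₀ : 0 ≤ x₀) (hx₁ : 0 ≤ x₁) (hy₀ : 0 ≤ y₀)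
    (hy₁ : 0 ≤ y₁) (hx : x₀ ^ 2 + x₁ ^ 2 = 1) (hy : y₀ ^ 2 + y₁ ^ 2 = 1)
    (hqp : q ![1, 0, 0] ![1, 0, 0] = 0)
    (hqs : q ![x₀ ^ 2, x₁ ^ 2, x₀ * x₁] ![y₀ ^ 2, y₁ ^ 2, y₀ * y₁] = 1) :
    x₀ * y₀ ≤ x₁ * y₁ := by
  by_contra! hlt
  have hS0 : 0 ≤ x₁ * y₀ + x₀ * y₁ := by positivity
  let e : Fin 3 → ℝ := ![1 / 2, 1 / 2, 0]
  let ca : Fin 3 → ℝ := ![x₀ / 2, -x₀ / 2, x₁ / 2]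
  -- `ca` points along the bisector of the two Bloch vectors and `sa` is orthogonal to it, so the
  -- two states differ only in the sign of the `sa` coefficient; likewise for `cb` and `sb`.
  let sa : Fin 3 → ℝ := ![-x₁ / 2, x₁ / 2, x₀ / 2]
  let cb : Fin 3 → ℝ := ![y₀ / 2, -y₀ / 2, y₁ / 2]
  let sb : Fin 3 → ℝ := ![-y₁ / 2, y₁ / 2, y₀ / 2]
  have odd : ∀ c s c' s' : ℝ,
      q (e + c • ca + s • sa) (e + c' • cb + s' • sb) -
        q (e + c • ca + (-s) • sa) (e + c' • cb + (-s') • sb) =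
      2 * q sa e * s + 2 * q e sb * s' + 2 * q sa cb * (s * c') + 2 * q ca sb * (c * s') := by
    intro c s c' s'
    simp only [map_add, map_smul, LinearMap.add_apply, LinearMap.smul_apply, smul_eq_mul]
    ring
  have hcirc : ∀ u v : ℝ, u ^ 2 + v ^ 2 = 1 →
      2 * q sa e * u + 2 * q e sb * v + 2 * q sa cb * u ^ 2 + 2 * q ca sb * v ^ 2 ≤ 1 := by
    intro u v huv
    have huv' : v ^ 2 + u ^ 2 = 1 := by linarith
    -- Complementary angles on the two circles: the mixed products `s * c'` and `c * s'` become the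
    -- squares `u ^ 2` and `v ^ 2`.
    have h1 := hq _ _ (isPos_rotation (c := v) (s := u) hx huv')
      (isPos_rotation (c := u) (s := v) hy huv)
    have h2 := hq _ _ (isPos_rotation (c := v) (s := -u) hx (by rw [neg_sq]; exact huv'))
      (isPos_rotation (c := u) (s := -v) hy (by rw [neg_sq]; exact huv))
    have h3 := odd v u u v
    have h4 : q (e + v • ca + u • sa) (e + u • cb + v • sb) ≤ 1 := by
      refine h1.2.trans (le_of_eq ?_)
      simp; ring
    have h5 : 0 ≤ q (e + v • ca + (-u) • sa) (e + u • cb + (-v) • sb) := h2.1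
    linarith
  have base : ∀ z₀ z₁ : ℝ, z₀ ^ 2 + z₁ ^ 2 = 1 →
      ![1 / 2, 1 / 2, 0] + z₀ • ![z₀ / 2, -z₀ / 2, z₁ / 2] +
        (-z₁) • ![-z₁ / 2, z₁ / 2, z₀ / 2] = (![1, 0, 0] : Fin 3 → ℝ) := by
    intro z₀ z₁ hz
    ext i; fin_cases i
    · simp; linear_combination hz / 2
    · simp; linear_combination -hz / 2
    · simp; ring
  have top : ∀ z₀ z₁ : ℝ, z₀ ^ 2 + z₁ ^ 2 = 1 →
      ![1 / 2, 1 / 2, 0] + z₀ • ![z₀ / 2, -z₀ / 2, z₁ / 2] +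
        z₁ • ![-z₁ / 2, z₁ / 2, z₀ / 2] = (![z₀ ^ 2, z₁ ^ 2, z₀ * z₁] : Fin 3 → ℝ) := by
    intro z₀ z₁ hz
    ext i; fin_cases i
    · simp; linear_combination -hz / 2
    · simp; linear_combination -hz / 2
    · simp; ring
  have hdiff := odd x₀ x₁ y₀ y₁
  simp only [e, ca, sa, cb, sb] at hdiff
  rw [base _ _ hx, base _ _ hy, top _ _ hx, top _ _ hy, hqp, hqs] at hdiff
  have hpyth : (x₁ * y₀ + x₀ * y₁) ^ 2 + (x₀ * y₀ - x₁ * y₁) ^ 2 = 1 := by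
    linear_combination (y₀ ^ 2 + y₁ ^ 2) * hx + hy
  -- If the sine of `a + b` is 0, the states coincide and `hdiff` reads `1 = 0`. Otherwise the
  -- circle bound forces this sine to be at least 1, although its cosine is positive.
  rcases hS0.eq_or_lt with hS | hS
  · have hx₀' : 0 < x₀ := by
      refine hx₀.lt_of_ne fun h => ?_
      rw [← h, zero_mul] at hlt
      exact absurd hlt (not_lt.2 (by positivity))
    have hy₀' : 0 < y₀ := by
      refine hy₀.lt_of_ne fun h => ?_
      rw [← h, mul_zero] at hlt
      exact absurd hlt (not_lt.2 (by positivity))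
    have h1 : x₁ = 0 := by
      have : x₁ * y₀ = 0 := le_antisymm (by linarith [mul_nonneg hx₀ hy₁]) (by positivity)
      exact (mul_eq_zero.1 this).resolve_right hy₀'.ne'
    have h2 : y₁ = 0 := by
      have : x₀ * y₁ = 0 := le_antisymm (by linarith [mul_nonneg hx₁ hy₀]) (by positivity)
      exact (mul_eq_zero.1 this).resolve_left hx₀'.ne'
    rw [h1, h2] at hdiff
    linarith
  · have hle := combination_le_of_circle hcirc hx₀ hx₁ hy₀ hy₁ hx hy hlt.le hS
    have hpos : 0 < (x₀ * y₀ - x₁ * y₁) ^ 2 := by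
      have := sub_pos.2 hlt
      positivity
    simp only [e, ca, sa, cb, sb] at hle
    nlinarith

/-! ### Reduction to the normalized pure case. -/

/-- Exchange of the two diagonal entries. -/
noncomputable def diagSwap : (Fin 3 → ℝ) →ₗ[ℝ] (Fin 3 → ℝ) :=
  LinearMap.funLeft ℝ ℝ ![1, 0, 2]

theorem diagSwap_apply (a : Fin 3 → ℝ) : diagSwap a = ![a 1, a 0, a 2] := by
  ext i; fin_cases i <;> rfl

theorem IsPos.diagSwap {a : Fin 3 → ℝ} (ha : IsPos a) : IsPos (diagSwap a) := by
  rw [diagSwap_apply]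
  exact ⟨ha.2.1, ha.1, by simpa [mul_comm] using ha.2.2⟩

theorem IsEffect.comp_diagSwap {q : (Fin 3 → ℝ) →ₗ[ℝ] (Fin 3 → ℝ) →ₗ[ℝ] ℝ}
    (hq : IsEffect q) : IsEffect (q.comp diagSwap) := fun a b ha hb => by
  have := hq _ b ha.diagSwap hb
  rw [diagSwap_apply a] at this
  rw [LinearMap.comp_apply, diagSwap_apply]
  simpa [add_comm] using this

theorem IsEffect.compl_diagSwap {q : (Fin 3 → ℝ) →ₗ[ℝ] (Fin 3 → ℝ) →ₗ[ℝ] ℝ}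
    (hq : IsEffect q) : IsEffect (q.compl₂ diagSwap) :=
  (hq.flip.comp_diagSwap).flip

/-- The coordinates of the marginal `[[1 - α, β], [β, α]]`. -/
def marginal (α β : ℝ) : Fin 3 → ℝ := ![1 - α, α, β]

theorem diagSwap_marginal (α β : ℝ) : diagSwap (marginal α β) = marginal (1 - α) β := by
  rw [diagSwap_apply]; simp [marginal]

theorem symTrace_marginal (p α β : ℝ) :
    symTrace (marginal p 0) (marginal α β) = (1 - p) * (1 - α) + p * α := by
  simp [symTrace, marginal]

theorem isPos_marginal {α β : ℝ} (hα : α ∈ Set.Icc (0 : ℝ) 1) (h : β ^ 2 ≤ α * (1 - α)) :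
    IsPos (marginal α β) :=
  ⟨by simpa [marginal] using hα.2, by simpa [marginal] using hα.1, by
    simp [marginal]; linarith⟩

theorem one_sub_mem_Icc {α : ℝ} (hα : α ∈ Set.Icc (0 : ℝ) 1) : 1 - α ∈ Set.Icc (0 : ℝ) 1 :=
  ⟨by linarith [hα.2], by linarith [hα.1]⟩

/-- Purity lets `√(1 - α)` and `√α` serve as cosine and sine of half the Bloch angle, with product
`β`. -/
theorem IsEffect.marginal_pure {q : (Fin 3 → ℝ) →ₗ[ℝ] (Fin 3 → ℝ) →ₗ[ℝ] ℝ} (hq : IsEffect q)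
    {α₁ α₂ β₁ β₂ : ℝ} (hα₁ : α₁ ∈ Set.Icc (0 : ℝ) 1) (hα₂ : α₂ ∈ Set.Icc (0 : ℝ) 1)
    (hβ₁ : 0 ≤ β₁) (hβ₂ : 0 ≤ β₂) (h₁ : β₁ ^ 2 = α₁ * (1 - α₁)) (h₂ : β₂ ^ 2 = α₂ * (1 - α₂))
    (hqp : q (marginal 0 0) (marginal 0 0) = 0)
    (hqs : q (marginal α₁ β₁) (marginal α₂ β₂) = 1) :
    (1 - α₁) * (1 - α₂) ≤ β₁ * β₂ := by
  have hb : ∀ {α β : ℝ}, α ∈ Set.Icc (0 : ℝ) 1 → 0 ≤ β → β ^ 2 = α * (1 - α) →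
      β = √(1 - α) * √α := by
    intro α β hα hβ h
    rw [← Real.sqrt_mul (by linarith [hα.2]), ← Real.sqrt_sq hβ, h, mul_comm]
  have hm : ∀ {α β : ℝ}, α ∈ Set.Icc (0 : ℝ) 1 → 0 ≤ β → β ^ 2 = α * (1 - α) →
      marginal α β = ![√(1 - α) ^ 2, √α ^ 2, √(1 - α) * √α] := by
    intro α β hα hβ h
    rw [Real.sq_sqrt hα.1, Real.sq_sqrt (by linarith [hα.2]), ← hb hα hβ h, marginal]
  have hone : ∀ {α : ℝ}, α ∈ Set.Icc (0 : ℝ) 1 → √(1 - α) ^ 2 + √α ^ 2 = 1 := by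
    intro α hα
    rw [Real.sq_sqrt hα.1, Real.sq_sqrt (by linarith [hα.2])]; ring
  have h0 : marginal 0 0 = ![1, 0, 0] := by simp [marginal]
  rw [h0] at hqp
  rw [hm hα₁ hβ₁ h₁, hm hα₂ hβ₂ h₂] at hqs
  have key := hq.mul_le_mul_of_pure (Real.sqrt_nonneg _) (Real.sqrt_nonneg _)
    (Real.sqrt_nonneg _) (Real.sqrt_nonneg _) (hone hα₁) (hone hα₂) hqp hqs
  have := mul_le_mul_of_nonneg_left key
    (mul_nonneg (Real.sqrt_nonneg (1 - α₁)) (Real.sqrt_nonneg (1 - α₂)))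
  rw [hb hα₁ hβ₁ h₁, hb hα₂ hβ₂ h₂]
  have e1 := Real.sq_sqrt (show 0 ≤ 1 - α₁ by linarith [hα₁.2])
  have e2 := Real.sq_sqrt (show 0 ≤ 1 - α₂ by linarith [hα₂.2])
  calc (1 - α₁) * (1 - α₂) = √(1 - α₁) ^ 2 * √(1 - α₂) ^ 2 := by rw [e1, e2]
    _ = √(1 - α₁) * √(1 - α₂) * (√(1 - α₁) * √(1 - α₂)) := by ring
    _ ≤ _ := this
    _ = _ := by ring

theorem IsEffect.symTrace_mul_le {q : (Fin 3 → ℝ) →ₗ[ℝ] (Fin 3 → ℝ) →ₗ[ℝ] ℝ}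
    (hq : IsEffect q) {p₁ p₂ α₁ α₂ β₁ β₂ : ℝ}
    (hp₁ : p₁ ∈ Set.Icc (0 : ℝ) 1) (hp₂ : p₂ ∈ Set.Icc (0 : ℝ) 1)
    (hα₁ : α₁ ∈ Set.Icc (0 : ℝ) 1) (hα₂ : α₂ ∈ Set.Icc (0 : ℝ) 1)
    (hβ₁ : 0 ≤ β₁) (hβ₂ : 0 ≤ β₂)
    (h₁ : β₁ ^ 2 ≤ α₁ * (1 - α₁)) (h₂ : β₂ ^ 2 ≤ α₂ * (1 - α₂))
    (hqp : q (marginal p₁ 0) (marginal p₂ 0) = 0)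
    (hqs : q (marginal α₁ β₁) (marginal α₂ β₂) = 1) :
    symTrace (marginal p₁ 0) (marginal α₁ β₁) * symTrace (marginal p₂ 0) (marginal α₂ β₂) ≤
      β₁ * β₂ * |(2 * p₁ - 1) * (2 * p₂ - 1)| := by
  have hdiag : ∀ {p : ℝ}, p ∈ Set.Icc (0 : ℝ) 1 → (0 : ℝ) ^ 2 ≤ p * (1 - p) := fun hp => by
    rw [zero_pow two_ne_zero]
    exact mul_nonneg hp.1 (by linarith [hp.2])
  have htr : ∀ α β : ℝ, marginal α β 0 + marginal α β 1 = 1 := fun α β => by simp [marginal]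
  by_cases hdet : (0 : ℝ) ^ 2 < p₁ * (1 - p₁) ∨ (0 : ℝ) ^ 2 < p₂ * (1 - p₂) ∨
      β₁ ^ 2 < α₁ * (1 - α₁) ∨ β₂ ^ 2 < α₂ * (1 - α₂)
  · rw [hq.symTrace_mul_eq_zero (isPos_marginal hp₁ (hdiag hp₁)) (isPos_marginal hp₂ (hdiag hp₂))
      (isPos_marginal hα₁ h₁) (isPos_marginal hα₂ h₂) (htr _ _) (htr _ _) (htr _ _) (htr _ _)
      hqp hqs (by simpa [marginal, mul_comm] using hdet)]
    positivity
  · simp only [not_or, not_lt] at hdet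
    obtain ⟨d1, d2, d3, d4⟩ := hdet
    have hext : ∀ {p : ℝ}, p ∈ Set.Icc (0 : ℝ) 1 → p * (1 - p) ≤ 0 ^ 2 → p = 0 ∨ p = 1 := by
      intro p hp h
      have := mul_eq_zero.1 (le_antisymm (h.trans_eq (by norm_num))
        (mul_nonneg hp.1 (by linarith [hp.2])))
      rcases this with h | h
      · exact Or.inl h
      · exact Or.inr (by linarith)
    have h₁' := le_antisymm h₁ d3
    have h₂' := le_antisymm h₂ d4
    have h₁'' : β₁ ^ 2 = (1 - α₁) * (1 - (1 - α₁)) := by rw [h₁']; ring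
    have h₂'' : β₂ ^ 2 = (1 - α₂) * (1 - (1 - α₂)) := by rw [h₂']; ring
    have s0 : ∀ β : ℝ, diagSwap (marginal 0 β) = marginal 1 β := fun β => by
      rw [diagSwap_marginal, sub_zero]
    have s1 : ∀ α β : ℝ, diagSwap (marginal (1 - α) β) = marginal α β := fun α β => by
      rw [diagSwap_marginal, sub_sub_cancel]
    rcases hext hp₁ d1 with rfl | rfl <;> rcases hext hp₂ d2 with rfl | rfl
    · have := hq.marginal_pure hα₁ hα₂ hβ₁ hβ₂ h₁' h₂' hqp hqs
      norm_num [symTrace_marginal]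
      linarith
    · have := hq.compl_diagSwap.marginal_pure hα₁ (one_sub_mem_Icc hα₂) hβ₁ hβ₂ h₁' h₂''
        (by rw [LinearMap.compl₂_apply, s0, hqp]) (by rw [LinearMap.compl₂_apply, s1, hqs])
      norm_num [symTrace_marginal]
      linarith
    · have := hq.comp_diagSwap.marginal_pure (one_sub_mem_Icc hα₁) hα₂ hβ₁ hβ₂ h₁'' h₂'
        (by rw [LinearMap.comp_apply, s0, hqp]) (by rw [LinearMap.comp_apply, s1, hqs])
      norm_num [symTrace_marginal]
      linarith
    · have := hq.comp_diagSwap.compl_diagSwap.marginal_pure (one_sub_mem_Icc hα₁)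
        (one_sub_mem_Icc hα₂) hβ₁ hβ₂ h₁'' h₂''
        (by rw [LinearMap.compl₂_apply, LinearMap.comp_apply, s0, hqp])
        (by rw [LinearMap.compl₂_apply, LinearMap.comp_apply, s1, s1, hqs])
      norm_num [symTrace_marginal]
      linarith

/-! ### Traces of the given states and the conclusion. -/

theorem trace_symMat_mul (a b : Fin 3 → ℝ) :
    (symMat a * symMat b).trace = (symTrace a b : ℂ) := by
  simp [symMat, symTrace, Matrix.trace_fin_two]
  ring

theorem symMat_marginal (α β : ℝ) :
    symMat (marginal α β) = !![1 - (α : ℂ), (β : ℂ); (β : ℂ), (α : ℂ)] := by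
  simp [symMat, marginal]

end SepGPT

theorem theorem4 (p₁ p₂ α₁ α₂ β₁ β₂ : ℝ)
    (hp₁ : p₁ ∈ Set.Icc (0 : ℝ) 1) (hp₂ : p₂ ∈ Set.Icc (0 : ℝ) 1)
    (hα₁ : α₁ ∈ Set.Icc (0 : ℝ) 1) (hα₂ : α₂ ∈ Set.Icc (0 : ℝ) 1)
    (hβ₁ : 0 ≤ β₁) (hβ₂ : 0 ≤ β₂)
    (hαβ₁ : β₁ ^ 2 ≤ α₁ * (1 - α₁)) (hαβ₂ : β₂ ^ 2 ≤ α₂ * (1 - α₂))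
    (ρ₁ ρ₂ : Matrix (Fin 2 × Fin 2) (Fin 2 × Fin 2) ℂ)
    (hρ₁ : ρ₁ = !![1 - (p₁ : ℂ), 0; 0, (p₁ : ℂ)] ⊗ₖ !![1 - (p₂ : ℂ), 0; 0, (p₂ : ℂ)])
    (hρ₂ : ρ₂ = !![1 - (α₁ : ℂ), (β₁ : ℂ); (β₁ : ℂ), (α₁ : ℂ)] ⊗ₖ
      !![1 - (α₂ : ℂ), (β₂ : ℂ); (β₂ : ℂ), (α₂ : ℂ)])
    (hdist : SepGPT.PerfectlyDistinguishable ![ρ₁, ρ₂]) :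
    ((ρ₁ * ρ₂).trace.re ≤ β₁ * β₂ * |(2 * p₁ - 1) * (2 * p₂ - 1)| ∧
      β₁ * β₂ * |(2 * p₁ - 1) * (2 * p₂ - 1)| ≤ β₁ * β₂ ∧
      β₁ * β₂ ≤ 1 / 4) ∧
    (p₁ = 0 → p₂ = 0 → 1 ≤ α₁ + α₂) := by
  have e₁ : ρ₁ = SepGPT.symMat (SepGPT.marginal p₁ 0) ⊗ₖ SepGPT.symMat (SepGPT.marginal p₂ 0) := by
    rw [hρ₁, SepGPT.symMat_marginal, SepGPT.symMat_marginal, Complex.ofReal_zero]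
  have e₂ : ρ₂ = SepGPT.symMat (SepGPT.marginal α₁ β₁) ⊗ₖ
      SepGPT.symMat (SepGPT.marginal α₂ β₂) := by
    rw [hρ₂, SepGPT.symMat_marginal, SepGPT.symMat_marginal]
  obtain ⟨M, ⟨hM, hsum⟩, hδ⟩ := hdist
  rw [Fin.sum_univ_two] at hsum
  have hq := SepGPT.isEffect_symForm (hM 1) (hM 0) hsum
  have hqp : SepGPT.symForm (M 1) (SepGPT.marginal p₁ 0) (SepGPT.marginal p₂ 0) = 0 := by
    have := hδ 0 1
    rw [SepGPT.symForm_apply, ← e₁, Matrix.trace_mul_comm]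
    simp at this
    simp [this]
  have hqs : SepGPT.symForm (M 1) (SepGPT.marginal α₁ β₁) (SepGPT.marginal α₂ β₂) = 1 := by
    have := hδ 1 1
    rw [SepGPT.symForm_apply, ← e₂, Matrix.trace_mul_comm]
    simp at this
    simp [this]
  have key := hq.symTrace_mul_le hp₁ hp₂ hα₁ hα₂ hβ₁ hβ₂ hαβ₁ hαβ₂ hqp hqs
  have htr : (ρ₁ * ρ₂).trace.re = SepGPT.symTrace (SepGPT.marginal p₁ 0) (SepGPT.marginal α₁ β₁) *
      SepGPT.symTrace (SepGPT.marginal p₂ 0) (SepGPT.marginal α₂ β₂) := by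
    rw [e₁, e₂, ← Matrix.mul_kronecker_mul, Matrix.trace_kronecker, SepGPT.trace_symMat_mul,
      SepGPT.trace_symMat_mul, ← Complex.ofReal_mul, Complex.ofReal_re]
  have hhalf : ∀ {α β : ℝ}, 0 ≤ β → β ^ 2 ≤ α * (1 - α) → β ≤ 1 / 2 := fun {α β} hβ h => by
    nlinarith [sq_nonneg (α - 1 / 2)]
  have habs : ∀ {p : ℝ}, p ∈ Set.Icc (0 : ℝ) 1 → |2 * p - 1| ≤ 1 := fun hp =>
    abs_le.2 ⟨by linarith [hp.1], by linarith [hp.2]⟩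
  refine ⟨⟨htr ▸ key, ?_, ?_⟩, ?_⟩
  · refine mul_le_of_le_one_right (mul_nonneg hβ₁ hβ₂) ?_
    rw [abs_mul]
    exact mul_le_one₀ (habs hp₁) (abs_nonneg _) (habs hp₂)
  · have := mul_le_mul (hhalf hβ₁ hαβ₁) (hhalf hβ₂ hαβ₂) hβ₂ (by norm_num)
    linarith
  · rintro rfl rfl
    by_contra! hlt
    simp [SepGPT.symTrace_marginal] at key
    have h1 : 0 < 1 - α₁ := by linarith [hα₂.1]
    have h2 : 0 < 1 - α₂ := by linarith [hα₁.1]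
    have hpos := mul_pos h1 h2
    -- Squaring eliminates the β's; cancelling `(1 - α₁) * (1 - α₂) > 0` would leave `(1 - α₁) * (1
    -- - α₂) ≤ α₁ * α₂`, that is `1 ≤ α₁ + α₂`.
    have hsq : ((1 - α₁) * (1 - α₂)) ^ 2 ≤ (α₁ * (1 - α₁)) * (α₂ * (1 - α₂)) :=
      calc ((1 - α₁) * (1 - α₂)) ^ 2 ≤ (β₁ * β₂) ^ 2 := pow_le_pow_left₀ hpos.le key 2
        _ = β₁ ^ 2 * β₂ ^ 2 := mul_pow _ _ _
        _ ≤ _ := mul_le_mul hαβ₁ hαβ₂ (sq_nonneg _) (mul_nonneg hα₁.1 h1.le)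
    have : 0 < (1 - α₁) * (1 - α₂) * (1 - α₁ - α₂) := mul_pos hpos (by linarith)
    nlinarith
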